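/- The countably branching diamond graphs $D_\alpha^\omega$, for ordinals $\alpha<\omega_1$, are weighted graphs with two distinguished vertices, a top $t_\alpha$ and a bottom $b_\alpha$, defined by transfinite induction; $d_\alpha$ denotes the shortest path metric of $D_\alpha^\omega$ (the infimum of the total lengths of finite paths). - $D_0^\omega=\{t_0,b_0\}$ is a single edge of length $1$. - Let $D_1^\omega$ be the complete bipartite graph between $\{t_1,b_1\}$ and $\{x_i: i<\omega\}$, with edges of length $\frac12$. Then $D_{\alpha+1}^\omega$ is obtained by replacing every edge of $D_1^\omega$ by a copy of $D_\alpha^\omega$ with all edge lengths multiplied by $\frac12$: in the copy that replaces $\{t_1,x_i\}$ the top is identified with $t_1$ and the bottom with $x_i$; in the copy that replaces $\{b_1,x_i\}$ the top is identified with $x_i$ and the bottom with $b_1$. Its top and bottom are $t_1$ and $b_1$. (For $\alpha=0$ this gives back $D_1^\omega$.) - If $\alpha<\omega_1$ is a limit ordinal, one chooses an enumeration $(\beta_n)_{n\in\omega}$ of all ordinals less than $\alpha$, and $D_\alpha^\omega$ is the disjoint union of the graphs $D_{\beta_n}^\omega$, $n\in\omega$, with all the tops $t_{\beta_n}$ identified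 to one point $t_\alpha$ and all the bottoms $b_{\beta_n}$ identified to one point $b_\alpha$. **Corollary.** For every choice of the enumerations at limit ordinals and every $\alpha\in(0,\omega_1)$, there exists a map $\Psi_\alpha\colon D_\alpha^\omega\to L_1[0,1]$ such that, for all $x,y\in D_\alpha^\omega$, $$\tfrac12\, d_\alpha(x,y)\le \|\Psi_\alpha(x)-\Psi_\alpha(y)\|_1\le d_\alpha(x,y).$$ -/

import Mathlib

open scoped NNReal

/-- A weighted graph with two distinguished vertices, the *top* and the *bottom*.
`edge u v w` says that `u` and `v` are joined by an edge of weight (length) `w`. -/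
structure PoledGraph where
  /-- the set of vertices -/
  V : Type
  /-- the top pole -/
  top : V
  /-- the bottom pole -/
  bot : V
  /-- the weighted adjacency relation -/
  edge : V → V → ℝ≥0 → Prop

namespace PoledGraph

/-- `G.Walk x y L`: there is a finite path of edges from `x` to `y` of total length `L`. -/
inductive Walk (G : PoledGraph) : G.V → G.V → ℝ≥0 → Prop
  | nil (x : G.V) : Walk G x x 0
  | cons {x y z : G.V} {w L : ℝ≥0} : G.edge x y w → Walk G y z L → Walk G x z (w + L)

/-- The shortest path metric of a weighted graph: the infimum of the lengths of all paths. -/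
noncomputable def pathDist (G : PoledGraph) (x y : G.V) : ℝ≥0 :=
  sInf {L : ℝ≥0 | G.Walk x y L}

/-- A single edge of length `1` between two points: `true` is the top, `false` the bottom. -/
def single : PoledGraph where
  V := Bool
  top := true
  bot := false
  edge u v w := u ≠ v ∧ w = 1

/-- The identifications made when every edge `(j, ±)` of the graph with vertices
`t, b, x_j` (`j < ω`) and edges `(j, +) = {t, x_j}`, `(j, -) = {b, x_j}` is replaced by a copy
of `G`. The point `(j, true, u)` is the copy of `u` in position `(j, +)`, and `(j, false, u)`
is the copy of `u` in position `(j, -)`. -/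
inductive SuccGlue (G : PoledGraph) : ℕ × Bool × G.V → ℕ × Bool × G.V → Prop
  /-- all tops of the copies `(j, +)` become the vertex `t` -/
  | top (i j : ℕ) : SuccGlue G (i, true, G.top) (j, true, G.top)
  /-- all bottoms of the copies `(j, -)` become the vertex `b` -/
  | bot (i j : ℕ) : SuccGlue G (i, false, G.bot) (j, false, G.bot)
  /-- the bottom of the copy `(i, +)` and the top of the copy `(i, -)` become the vertex `x_i` -/
  | mid (i : ℕ) : SuccGlue G (i, true, G.bot) (i, false, G.top)

/-- The edges of the successor step: those of the copies of `G`, with lengths halved. -/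
inductive SuccEdge (G : PoledGraph) : Quot G.SuccGlue → Quot G.SuccGlue → ℝ≥0 → Prop
  | mk (j : ℕ) (s : Bool) {u v : G.V} {w : ℝ≥0} : G.edge u v w →
      SuccEdge G (Quot.mk _ (j, s, u)) (Quot.mk _ (j, s, v)) (w / 2)

/-- The successor step: each edge of the original countably branching diamond `D₁` is replaced
by a copy of `G` scaled by `1/2`. -/
def succ (G : PoledGraph) : PoledGraph where
  V := Quot G.SuccGlue
  top := Quot.mk _ (0, true, G.top)
  bot := Quot.mk _ (0, false, G.bot)
  edge := G.SuccEdge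

/-- The identifications made in the disjoint union of the `G n`: all the tops are identified,
and all the bottoms are identified. -/
inductive UnionGlue (G : ℕ → PoledGraph) : (Σ n, (G n).V) → (Σ n, (G n).V) → Prop
  | top (m n : ℕ) : UnionGlue G ⟨m, (G m).top⟩ ⟨n, (G n).top⟩
  | bot (m n : ℕ) : UnionGlue G ⟨m, (G m).bot⟩ ⟨n, (G n).bot⟩

/-- The edges of the glued union: those of the `G n`, with unchanged lengths. -/
inductive UnionEdge (G : ℕ → PoledGraph) :
    Quot (UnionGlue G) → Quot (UnionGlue G) → ℝ≥0 → Prop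
  | mk (n : ℕ) {u v : (G n).V} {w : ℝ≥0} : (G n).edge u v w →
      UnionEdge G (Quot.mk _ ⟨n, u⟩) (Quot.mk _ ⟨n, v⟩) w

/-- The limit step: the disjoint union of the `G n` with all tops and all bottoms identified. -/
def union (G : ℕ → PoledGraph) : PoledGraph where
  V := Quot (UnionGlue G)
  top := Quot.mk _ ⟨0, (G 0).top⟩
  bot := Quot.mk _ ⟨0, (G 0).bot⟩
  edge := UnionEdge G

end PoledGraph

/-- A choice, for every limit ordinal `α`, of a sequence of ordinals less than `α`. -/
abbrev LimitSequences : Type 1 :=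
  (α : Ordinal.{0}) → Order.IsSuccLimit α → ℕ → Set.Iio α

/-- The sequence chosen for each countable limit ordinal `α` enumerates all ordinals less
than `α`. -/
def LimitSequences.Enumerates (e : LimitSequences) : Prop :=
  ∀ (α : Ordinal.{0}) (hα : Order.IsSuccLimit α), α < Ordinal.omega 1 →
    Function.Surjective (e α hα)

/-- The countably branching diamond graph of height `α`, built with the enumerations `e` at
limit ordinals: a single edge for `α = 0`, the successor step for `α + 1`, and the glued union
of all previous diamond graphs for `α` limit. -/
noncomputable def diamond (e : LimitSequences) (α : Ordinal.{0}) : PoledGraph :=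
  Ordinal.limitRecOn α PoledGraph.single (fun _ G => G.succ)
    (fun α hα G => PoledGraph.union fun n => G (e α hα n) (e α hα n).2)

theorem diamond_zero (e : LimitSequences) : diamond e 0 = PoledGraph.single :=
  Ordinal.limitRecOn_zero ..

theorem diamond_add_one (e : LimitSequences) (α : Ordinal.{0}) :
    diamond e (α + 1) = (diamond e α).succ :=
  Ordinal.limitRecOn_add_one ..

theorem diamond_limit (e : LimitSequences) (α : Ordinal.{0}) (hα : Order.IsSuccLimit α) :
    diamond e α = PoledGraph.union fun n => diamond e (e α hα n) :=
  Ordinal.limitRecOn_limit ..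

/-! The diamond graphs are connected, so that `pathDist` is the infimum of a non-empty set. -/

namespace PoledGraph

theorem Walk.append {G : PoledGraph} {x y z : G.V} {L M : ℝ≥0} (h : G.Walk x y L)
    (h' : G.Walk y z M) : G.Walk x z (L + M) := by
  induction h with
  | nil => simpa using h'
  | cons hw _ ih => rw [add_assoc]; exact .cons hw (ih h')

/-- Any two vertices are joined by a path. -/
def Connected (G : PoledGraph) : Prop :=
  ∀ x y : G.V, ∃ L, G.Walk x y L

theorem Connected.of_bot {G : PoledGraph}
    (h : ∀ x, (∃ L, G.Walk x G.bot L) ∧ ∃ L, G.Walk G.bot x L) : G.Connected := fun x y => by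
  obtain ⟨L, hL⟩ := (h x).1
  obtain ⟨M, hM⟩ := (h y).2
  exact ⟨_, hL.append hM⟩

theorem single_connected : single.Connected := by
  intro x y
  by_cases h : x = y
  · subst h; exact ⟨0, .nil x⟩
  · exact ⟨1 + 0, .cons ⟨h, rfl⟩ (.nil y)⟩

theorem Walk.succ_copy {G : PoledGraph} (j : ℕ) (s : Bool) {x y : G.V} {L : ℝ≥0}
    (h : G.Walk x y L) :
    ∃ M, G.succ.Walk (Quot.mk _ (j, s, x)) (Quot.mk _ (j, s, y)) M := by
  induction h with
  | nil => exact ⟨0, .nil _⟩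
  | cons hw _ ih =>
    obtain ⟨M, hM⟩ := ih
    exact ⟨_, .cons (SuccEdge.mk j s hw) hM⟩

theorem Walk.union_copy {G : ℕ → PoledGraph} (n : ℕ) {x y : (G n).V} {L : ℝ≥0}
    (h : (G n).Walk x y L) : (union G).Walk (Quot.mk _ ⟨n, x⟩) (Quot.mk _ ⟨n, y⟩) L := by
  induction h with
  | nil => exact .nil _
  | cons hw _ ih => exact .cons (UnionEdge.mk n hw) ih

theorem Connected.succ {G : PoledGraph} (h : G.Connected) : G.succ.Connected := by
  have low : ∀ j u v, ∃ L, G.succ.Walk (Quot.mk _ (j, false, u)) (Quot.mk _ (j, false, v)) L :=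
    fun j u v => (h u v).elim fun _ hL => hL.succ_copy j false
  have up : ∀ j u v, ∃ L, G.succ.Walk (Quot.mk _ (j, true, u)) (Quot.mk _ (j, true, v)) L :=
    fun j u v => (h u v).elim fun _ hL => hL.succ_copy j true
  have hb : ∀ j, G.succ.bot = Quot.mk _ (j, false, G.bot) := fun j => Quot.sound (.bot 0 j)
  have hm : ∀ j, (Quot.mk _ (j, true, G.bot) : G.succ.V) = Quot.mk _ (j, false, G.top) :=
    fun j => Quot.sound (.mid j)
  refine .of_bot fun x => ?_
  obtain ⟨⟨j, s, u⟩, rfl⟩ := Quot.exists_rep x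
  rw [hb j]
  cases s with
  | false => exact ⟨low j _ _, low j _ _⟩
  | true =>
    obtain ⟨L₁, h₁⟩ := up j u G.bot
    obtain ⟨L₂, h₂⟩ := low j G.top G.bot
    obtain ⟨L₃, h₃⟩ := low j G.bot G.top
    obtain ⟨L₄, h₄⟩ := up j G.bot u
    rw [hm j] at h₁ h₄
    exact ⟨⟨_, h₁.append h₂⟩, ⟨_, h₃.append h₄⟩⟩

theorem Connected.union {G : ℕ → PoledGraph} (h : ∀ n, (G n).Connected) :
    (union G).Connected := by
  have hb : ∀ n, (PoledGraph.union G).bot = Quot.mk _ ⟨n, (G n).bot⟩ :=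
    fun n => Quot.sound (.bot 0 n)
  refine .of_bot fun x => ?_
  obtain ⟨⟨n, u⟩, rfl⟩ := Quot.exists_rep x
  rw [hb n]
  exact ⟨(h n _ _).elim fun L hL => ⟨L, hL.union_copy n⟩,
    (h n _ _).elim fun L hL => ⟨L, hL.union_copy n⟩⟩

end PoledGraph

theorem diamond_connected (e : LimitSequences) (α : Ordinal.{0}) : (diamond e α).Connected := by
  induction α using Ordinal.limitRecOn with
  | zero => rw [diamond_zero]; exact PoledGraph.single_connected
  | add_one α ih => rw [diamond_add_one]; exact ih.succ
  | limit α hα ih =>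
    rw [diamond_limit e α hα]
    exact PoledGraph.Connected.union fun n => ih _ (e α hα n).2

/-! Each vertex becomes an event in the unit interval: the top is the whole space, the bottom is
empty, and the probability is the height above the bottom. Indicators then embed the graph in L₁,
with distance the measure of the symmetric difference. The upper bound need only be checked on
edges. For the lower bound, different branches are made independent: events of probabilities `a`,
`b` differ with measure `a(1-b) + b(1-a)`, at least half the length `min (a+b) (2-a-b)` of a route
through a pole (`walkLE_through_pole`). Inside a branch the bound is inherited. Since countably many
independent copies again fit on the unit interval (`exists_indep_copies`), the induction closes
under both constructions. -/

open MeasureTheory ProbabilityTheory Set unitInterval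

open scoped symmDiff

/-! ### Independent copies and symmetric differences -/

/-- A probability measure on a standard Borel space is the law of a sequence of pairwise
independent variables on the unit interval. -/
theorem exists_indep_copies {Ω : Type*} [MeasurableSpace Ω] [StandardBorelSpace Ω] [Nonempty Ω]
    (μ : Measure Ω) [IsProbabilityMeasure μ] :
    ∃ X : ℕ → I → Ω, (∀ n, MeasurePreserving (X n) volume μ) ∧
      Pairwise fun m n => IndepFun (X m) (X n) volume := by
  -- The infinite power of `μ` is itself standard Borel, hence the law of some `f` on the interval;
  -- its coordinates are the copies.
  obtain ⟨f, hf, hmap⟩ := Measure.exists_measurable_map_eq (Measure.infinitePi fun _ : ℕ => μ)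
  have hev : ∀ n, MeasurePreserving (fun t => f t n) volume μ := fun n =>
    (measurePreserving_eval_infinitePi (fun _ : ℕ => μ) n).comp ⟨hf, hmap⟩
  refine ⟨fun n t => f t n, hev, fun m n hmn => ?_⟩
  have hind : IndepFun (fun ω : ℕ → Ω => ω m) (fun ω => ω n) (Measure.infinitePi fun _ => μ) :=
    (iIndepFun_infinitePi (P := fun _ : ℕ => μ) (X := fun _ ω => ω)
      (fun _ => measurable_id)).indepFun hmn
  refine (indepFun_iff_measure_inter_preimage_eq_mul).2 fun s t hs ht => ?_
  have h := hind.measure_inter_preimage_eq_mul _ _ hs ht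
  have hs' : MeasurableSet ((fun ω : ℕ → Ω => ω m) ⁻¹' s) := measurable_pi_apply m hs
  have ht' : MeasurableSet ((fun ω : ℕ → Ω => ω n) ⁻¹' t) := measurable_pi_apply n ht
  rw [← hmap, Measure.map_apply hf (hs'.inter ht'), Measure.map_apply hf hs',
    Measure.map_apply hf ht'] at h
  exact h

theorem measureReal_symmDiff_of_indepFun {Ω Ω' : Type*} [MeasurableSpace Ω] [MeasurableSpace Ω']
    {μ : Measure Ω} [IsProbabilityMeasure μ] {X Y : Ω → Ω'} (hX : Measurable X)
    (hY : Measurable Y) (h : IndepFun X Y μ) {A B : Set Ω'} (hA : MeasurableSet A)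
    (hB : MeasurableSet B) :
    μ.real ((X ⁻¹' A) ∆ (Y ⁻¹' B)) = μ.real (X ⁻¹' A) * (1 - μ.real (Y ⁻¹' B)) +
      μ.real (Y ⁻¹' B) * (1 - μ.real (X ⁻¹' A)) := by
  have hi : μ.real (X ⁻¹' A ∩ Y ⁻¹' B) = μ.real (X ⁻¹' A) * μ.real (Y ⁻¹' B) := by
    simp only [Measure.real, h.measure_inter_preimage_eq_mul _ _ hA hB, ENNReal.toReal_mul]
  have h₁ := measureReal_sdiff_add_inter (μ := μ) (s := X ⁻¹' A) (hY hB)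
  have h₂ := measureReal_sdiff_add_inter (μ := μ) (s := Y ⁻¹' B) (hX hA)
  rw [inter_comm] at h₂
  rw [measureReal_symmDiff_eq (hX hA) (hY hB)]
  linarith

theorem MeasureTheory.MeasurePreserving.real_symmDiff_preimage {Ω Ω' : Type*} [MeasurableSpace Ω]
    [MeasurableSpace Ω'] {μ : Measure Ω} {ν : Measure Ω'} {X : Ω → Ω'}
    (h : MeasurePreserving X μ ν) {A B : Set Ω'} (hA : MeasurableSet A) (hB : MeasurableSet B) :
    μ.real ((X ⁻¹' A) ∆ (X ⁻¹' B)) = ν.real (A ∆ B) := by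
  rw [← preimage_symmDiff, h.measureReal_preimage (hA.symmDiff hB).nullMeasurableSet]

namespace PoledGraph

/-! ### Walks of bounded length -/

/-- The adjacency relation is symmetric. -/
def Undirected (G : PoledGraph) : Prop :=
  ∀ ⦃u v w⦄, G.edge u v w → G.edge v u w

theorem Walk.reverse {G : PoledGraph} (hG : G.Undirected) {x y : G.V} {L : ℝ≥0}
    (h : G.Walk x y L) : G.Walk y x L := by
  induction h with
  | nil x => exact .nil x
  | cons hw _ ih => simpa [add_comm] using ih.append (.cons (hG hw) (.nil _))

theorem single_undirected : single.Undirected := fun _ _ _ h => ⟨h.1.symm, h.2⟩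

theorem Undirected.succ {G : PoledGraph} (h : G.Undirected) : G.succ.Undirected := by
  rintro _ _ _ ⟨j, s, hw⟩
  exact .mk j s (h hw)

theorem Undirected.union {G : ℕ → PoledGraph} (h : ∀ n, (G n).Undirected) :
    (union G).Undirected := by
  rintro _ _ _ ⟨n, hw⟩
  exact .mk n (h n hw)

theorem Walk.succ_half {G : PoledGraph} (j : ℕ) (s : Bool) {x y : G.V} {L : ℝ≥0}
    (h : G.Walk x y L) :
    G.succ.Walk (Quot.mk _ (j, s, x)) (Quot.mk _ (j, s, y)) (L / 2) := by
  induction h with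
  | nil => simpa using Walk.nil (G := G.succ) _
  | cons hw _ ih => rw [add_div]; exact .cons (SuccEdge.mk j s hw) ih

/-- `G.WalkLE x y r`: there is a path from `x` to `y` of length at most `r`. -/
def WalkLE (G : PoledGraph) (x y : G.V) (r : ℝ) : Prop :=
  ∃ L : ℝ≥0, G.Walk x y L ∧ (L : ℝ) ≤ r

theorem WalkLE.trans {G : PoledGraph} {x y z : G.V} {r s t : ℝ} (h : G.WalkLE x y r)
    (h' : G.WalkLE y z s) (hrs : r + s ≤ t) : G.WalkLE x z t := by
  obtain ⟨L, hL, hr⟩ := h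
  obtain ⟨M, hM, hs⟩ := h'
  exact ⟨L + M, hL.append hM, by push_cast; linarith⟩

theorem WalkLE.mono {G : PoledGraph} {x y : G.V} {r s : ℝ} (h : G.WalkLE x y r) (hrs : r ≤ s) :
    G.WalkLE x y s :=
  let ⟨L, hL, hr⟩ := h
  ⟨L, hL, hr.trans hrs⟩

theorem WalkLE.reverse {G : PoledGraph} (hG : G.Undirected) {x y : G.V} {r : ℝ}
    (h : G.WalkLE x y r) : G.WalkLE y x r :=
  let ⟨L, hL, hr⟩ := h
  ⟨L, hL.reverse hG, hr⟩

theorem WalkLE.succ_half {G : PoledGraph} (j : ℕ) (s : Bool) {x y : G.V} {r : ℝ}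
    (h : G.WalkLE x y r) :
    G.succ.WalkLE (Quot.mk _ (j, s, x)) (Quot.mk _ (j, s, y)) (r / 2) :=
  let ⟨L, hL, hr⟩ := h
  ⟨L / 2, hL.succ_half j s, by push_cast; linarith⟩

theorem WalkLE.union_copy {G : ℕ → PoledGraph} (n : ℕ) {x y : (G n).V} {r : ℝ}
    (h : (G n).WalkLE x y r) :
    (union G).WalkLE (Quot.mk _ ⟨n, x⟩) (Quot.mk _ ⟨n, y⟩) r :=
  let ⟨L, hL, hr⟩ := h
  ⟨L, hL.union_copy n, hr⟩

/-- Two vertices at heights `a` and `b` are joined through one of the poles by a path of length at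
most twice the measure of the symmetric difference of independent events of probabilities
`a` and `b`. -/
theorem walkLE_through_pole {G : PoledGraph} (hG : G.Undirected) {x y : G.V} {a b : ℝ}
    (ha₀ : 0 ≤ a) (ha₁ : a ≤ 1) (hb₀ : 0 ≤ b) (hb₁ : b ≤ 1)
    (hxt : G.WalkLE x G.top (1 - a)) (hxb : G.WalkLE x G.bot a)
    (hyt : G.WalkLE y G.top (1 - b)) (hyb : G.WalkLE y G.bot b) :
    G.WalkLE x y (2 * (a * (1 - b) + b * (1 - a))) := by
  -- Go through the nearer pole. For the bottom the slack is `(a-b)² + (a+b)(1-a-b)`; the top is the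
  -- same after `a ↦ 1-a`, `b ↦ 1-b`.
  rcases le_total (a + b) 1 with h | h
  · refine hxb.trans (hyb.reverse hG) ?_
    nlinarith [sq_nonneg (a - b), mul_nonneg (add_nonneg ha₀ hb₀) (sub_nonneg.2 h)]
  · refine hxt.trans (hyt.reverse hG) ?_
    nlinarith [sq_nonneg (a - b), mul_nonneg (sub_nonneg.2 h)
      (add_nonneg (sub_nonneg.2 ha₁) (sub_nonneg.2 hb₁))]

/-! ### Event representations and the limit step -/

/-- A representation of the vertices of `G` by events, such that the measure of symmetric
differences is at most the path distance and at least half of it, the height of a vertex being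
the probability of its event. -/
structure EventRep (G : PoledGraph) (F : G.V → Set I) : Prop where
  measurable : ∀ x, MeasurableSet (F x)
  top_eq : F G.top = univ
  bot_eq : F G.bot = ∅
  edge_le : ∀ ⦃u v w⦄, G.edge u v w → volume.real (F u ∆ F v) ≤ w
  walk_top : ∀ x, G.WalkLE x G.top (1 - volume.real (F x))
  walk_bot : ∀ x, G.WalkLE x G.bot (volume.real (F x))
  walk : ∀ x y, G.WalkLE x y (2 * volume.real (F x ∆ F y))

theorem EventRep.single : single.EventRep fun b : Bool => if b then univ else ∅ where
  measurable x := by cases x <;> simp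
  top_eq := by simp [PoledGraph.single]
  bot_eq := by simp [PoledGraph.single]
  edge_le u v w h := by
    rw [h.2]
    exact measureReal_le_one
  walk_top x := by
    cases x with
    | true => exact ⟨0, .nil _, by simp⟩
    | false => exact ⟨1 + 0, .cons ⟨Bool.false_ne_true, rfl⟩ (.nil _), by simp⟩
  walk_bot x := by
    cases x with
    | false => exact ⟨0, .nil _, by simp⟩
    | true => exact ⟨1 + 0, .cons ⟨Bool.false_ne_true.symm, rfl⟩ (.nil _), by simp⟩
  walk x y := by
    by_cases h : x = y
    · subst h
      exact ⟨0, .nil _, by positivity⟩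
    · refine ⟨1 + 0, .cons ⟨h, rfl⟩ (.nil _), ?_⟩
      cases x <;> cases y <;> first | exact absurd rfl h | simp [symmDiff_def]

/-- Pulling the `n`-th representation back along `X n` keeps all measures within a copy and makes
distinct copies independent. The gluing is respected because preimages of `univ` and `∅` do not
depend on `n`. -/
theorem exists_eventRep_union {G : ℕ → PoledGraph} (hG : ∀ n, (G n).Undirected)
    (h : ∀ n, ∃ F, (G n).EventRep F) : ∃ F, (union G).EventRep F := by
  choose F hF using h
  obtain ⟨X, hX, hind⟩ := exists_indep_copies (volume : Measure I)
  have hreal : ∀ n u, volume.real (X n ⁻¹' F n u) = volume.real (F n u) := fun n u =>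
    (hX n).measureReal_preimage ((hF n).measurable u).nullMeasurableSet
  have hsymm : ∀ n u v, volume.real ((X n ⁻¹' F n u) ∆ (X n ⁻¹' F n v)) =
      volume.real (F n u ∆ F n v) := fun n u v =>
    (hX n).real_symmDiff_preimage ((hF n).measurable u) ((hF n).measurable v)
  have htop : ∀ n, (union G).top = Quot.mk _ ⟨n, (G n).top⟩ := fun n => Quot.sound (.top 0 n)
  have hbot : ∀ n, (union G).bot = Quot.mk _ ⟨n, (G n).bot⟩ := fun n => Quot.sound (.bot 0 n)
  have wtop : ∀ n u, (union G).WalkLE (Quot.mk _ ⟨n, u⟩) (union G).top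
      (1 - volume.real (X n ⁻¹' F n u)) := fun n u => by
    rw [htop n, hreal]
    exact ((hF n).walk_top u).union_copy n
  have wbot : ∀ n u, (union G).WalkLE (Quot.mk _ ⟨n, u⟩) (union G).bot
      (volume.real (X n ⁻¹' F n u)) := fun n u => by
    rw [hbot n, hreal]
    exact ((hF n).walk_bot u).union_copy n
  refine ⟨Quot.lift (fun p => X p.1 ⁻¹' F p.1 p.2) ?_, ?_, ?_, ?_, ?_, ?_, ?_, ?_⟩
  · rintro _ _ (⟨m, n⟩ | ⟨m, n⟩)
    · simp only [(hF _).top_eq, preimage_univ]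
    · simp only [(hF _).bot_eq, preimage_empty]
  · rintro ⟨n, u⟩
    exact (hX n).measurable ((hF n).measurable u)
  · change X 0 ⁻¹' F 0 (G 0).top = univ
    rw [(hF 0).top_eq, preimage_univ]
  · change X 0 ⁻¹' F 0 (G 0).bot = ∅
    rw [(hF 0).bot_eq, preimage_empty]
  · rintro _ _ w ⟨n, hw⟩
    exact (hsymm n _ _).trans_le ((hF n).edge_le hw)
  · rintro ⟨n, u⟩
    exact wtop n u
  · rintro ⟨n, u⟩
    exact wbot n u
  · rintro ⟨m, u⟩ ⟨n, v⟩
    by_cases hmn : m = n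
    · subst hmn
      exact (((hF m).walk u v).union_copy m).mono (by rw [← hsymm m u v])
    · refine (walkLE_through_pole (.union hG) measureReal_nonneg measureReal_le_one
        measureReal_nonneg measureReal_le_one (wtop m u) (wbot m u) (wtop n v) (wbot n v)).mono ?_
      rw [← measureReal_symmDiff_of_indepFun (hX m).measurable (hX n).measurable (hind hmn)
        ((hF m).measurable u) ((hF n).measurable v)]

/-! ### The successor step -/

/-- The events of the two halves of a branch: the first coordinate is a fair coin which decides
the event of the midpoint; the upper half lives where the coin fails, the lower half where it
succeeds. -/
def halfEvent (s : Bool) (A : Set I) : Set (I × I) :=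
  if s then (Ioi ⟨1 / 2, by norm_num, by norm_num⟩ ×ˢ Aᶜ)ᶜ
  else Iic ⟨1 / 2, by norm_num, by norm_num⟩ ×ˢ A

theorem measurableSet_halfEvent (s : Bool) {A : Set I} (hA : MeasurableSet A) :
    MeasurableSet (halfEvent s A) := by
  cases s
  · exact measurableSet_Iic.prod hA
  · exact (measurableSet_Ioi.prod hA.compl).compl

theorem halfEvent_true_univ : halfEvent true univ = univ := by
  simp [halfEvent]

theorem halfEvent_false_empty : halfEvent false ∅ = ∅ := by
  simp [halfEvent]

/-- Both sides are the coin event, so the two halves agree at the midpoint. -/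
theorem halfEvent_true_empty : halfEvent true ∅ = halfEvent false univ := by
  ext ⟨a, b⟩
  simp [halfEvent]

theorem real_halfEvent_false (A : Set I) :
    (volume : Measure (I × I)).real (halfEvent false A) = volume.real A / 2 := by
  simp only [halfEvent, Bool.false_eq_true, if_false, Measure.volume_eq_prod,
    measureReal_prod_prod]
  rw [Measure.real, unitInterval.volume_Iic, ENNReal.toReal_ofReal (by norm_num)]
  ring

theorem real_halfEvent_true {A : Set I} (hA : MeasurableSet A) :
    (volume : Measure (I × I)).real (halfEvent true A) = (1 + volume.real A) / 2 := by
  simp only [halfEvent, if_true]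
  rw [probReal_compl_eq_one_sub (measurableSet_Ioi.prod hA.compl), Measure.volume_eq_prod,
    measureReal_prod_prod, probReal_compl_eq_one_sub hA, Measure.real, unitInterval.volume_Ioi,
    ENNReal.toReal_ofReal (by norm_num)]
  ring

theorem real_halfEvent_symmDiff (s : Bool) (A B : Set I) :
    (volume : Measure (I × I)).real (halfEvent s A ∆ halfEvent s B) = volume.real (A ∆ B) / 2 := by
  cases s
  · rw [← real_halfEvent_false]
    congr 1
    ext ⟨a, b⟩
    simp only [halfEvent, mem_symmDiff, mem_prod, Bool.false_eq_true, if_false]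
    tauto
  · have : halfEvent true A ∆ halfEvent true B =
        Ioi ⟨1 / 2, by norm_num, by norm_num⟩ ×ˢ (A ∆ B) := by
      ext ⟨a, b⟩
      simp only [halfEvent, mem_symmDiff, mem_compl_iff, mem_prod, if_true]
      tauto
    rw [this, Measure.volume_eq_prod, measureReal_prod_prod, Measure.real,
      unitInterval.volume_Ioi, ENNReal.toReal_ofReal (by norm_num)]
    ring

/-- The events are nested, so the measure is the difference of heights, which is also the length of
the walk through the midpoint. -/
theorem real_halfEvent_symmDiff_true_false {A B : Set I} (hA : MeasurableSet A)
    (hB : MeasurableSet B) :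
    (volume : Measure (I × I)).real (halfEvent true A ∆ halfEvent false B) =
      (1 - volume.real B) / 2 + volume.real A / 2 := by
  have hsub : halfEvent false B ⊆ halfEvent true A := by
    rintro ⟨a, b⟩
    simp only [halfEvent, mem_compl_iff, mem_prod, if_true, Bool.false_eq_true, if_false,
      mem_Iic, mem_Ioi]
    exact fun h h' => absurd h.1 h'.1.not_ge
  rw [symmDiff_of_ge hsub, measureReal_sdiff hsub (measurableSet_halfEvent _ hB),
    real_halfEvent_true hA, real_halfEvent_false]
  ring

theorem exists_eventRep_succ {G : PoledGraph} (hG : G.Undirected) (h : ∃ F, G.EventRep F) :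
    ∃ F, G.succ.EventRep F := by
  obtain ⟨F, hF⟩ := h
  obtain ⟨X, hX, hind⟩ := exists_indep_copies (volume : Measure (I × I))
  have hmeas : ∀ s u, MeasurableSet (halfEvent s (F u)) := fun s u =>
    measurableSet_halfEvent s (hF.measurable u)
  have hreal : ∀ j s u, volume.real (X j ⁻¹' halfEvent s (F u)) =
      volume.real (halfEvent s (F u)) := fun j s u =>
    (hX j).measureReal_preimage (hmeas s u).nullMeasurableSet
  have hsymm : ∀ j s t u v, volume.real ((X j ⁻¹' halfEvent s (F u)) ∆ (X j ⁻¹' halfEvent t (F v)))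
      = volume.real (halfEvent s (F u) ∆ halfEvent t (F v)) := fun j s t u v =>
    (hX j).real_symmDiff_preimage (hmeas s u) (hmeas t v)
  have htop : ∀ j, G.succ.top = Quot.mk _ (j, true, G.top) := fun j => Quot.sound (.top 0 j)
  have hbot : ∀ j, G.succ.bot = Quot.mk _ (j, false, G.bot) := fun j => Quot.sound (.bot 0 j)
  have hmid : ∀ j, (Quot.mk _ (j, true, G.bot) : G.succ.V) = Quot.mk _ (j, false, G.top) :=
    fun j => Quot.sound (.mid j)
  have wcross : ∀ j u v, G.succ.WalkLE (Quot.mk _ (j, true, u)) (Quot.mk _ (j, false, v))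
      ((1 - volume.real (F v)) / 2 + volume.real (F u) / 2) := fun j u v => by
    have h₁ := (hF.walk_bot u).succ_half j true
    rw [hmid] at h₁
    exact h₁.trans (((hF.walk_top v).reverse hG).succ_half j false) (add_comm _ _).le
  have wtop : ∀ j s u, G.succ.WalkLE (Quot.mk _ (j, s, u)) G.succ.top
      (1 - volume.real (X j ⁻¹' halfEvent s (F u))) := fun j s u => by
    rw [htop j, hreal]
    cases s with
    | true =>
      refine ((hF.walk_top u).succ_half j true).mono ?_
      rw [real_halfEvent_true (hF.measurable u)]
      linarith
    | false =>
      -- The top of the upper copy is the new top, so this walk passes through the midpoint.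
      refine ((wcross j G.top u).reverse hG.succ).mono ?_
      rw [real_halfEvent_false, hF.top_eq, probReal_univ]
      linarith
  have wbot : ∀ j s u, G.succ.WalkLE (Quot.mk _ (j, s, u)) G.succ.bot
      (volume.real (X j ⁻¹' halfEvent s (F u))) := fun j s u => by
    rw [hbot j, hreal]
    cases s with
    | true =>
      refine (wcross j u G.bot).mono ?_
      rw [real_halfEvent_true (hF.measurable u), hF.bot_eq, measureReal_empty]
      linarith
    | false =>
      refine ((hF.walk_bot u).succ_half j false).mono ?_
      rw [real_halfEvent_false]
  refine ⟨Quot.lift (fun p => X p.1 ⁻¹' halfEvent p.2.1 (F p.2.2)) ?_, ?_, ?_, ?_, ?_, ?_, ?_, ?_⟩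
  · rintro _ _ (⟨i, j⟩ | ⟨i, j⟩ | ⟨i⟩)
    · simp only [hF.top_eq, halfEvent_true_univ, preimage_univ]
    · simp only [hF.bot_eq, halfEvent_false_empty, preimage_empty]
    · simp only [hF.top_eq, hF.bot_eq, halfEvent_true_empty]
  · rintro ⟨j, s, u⟩
    exact (hX j).measurable (hmeas s u)
  · change X 0 ⁻¹' halfEvent true (F G.top) = univ
    rw [hF.top_eq, halfEvent_true_univ, preimage_univ]
  · change X 0 ⁻¹' halfEvent false (F G.bot) = ∅
    rw [hF.bot_eq, halfEvent_false_empty, preimage_empty]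
  · rintro _ _ _ ⟨j, s, hw⟩
    refine (hsymm j s s _ _).trans_le ?_
    rw [real_halfEvent_symmDiff]
    have := hF.edge_le hw
    push_cast
    linarith
  · rintro ⟨j, s, u⟩
    exact wtop j s u
  · rintro ⟨j, s, u⟩
    exact wbot j s u
  · rintro ⟨j, s, u⟩ ⟨k, t, v⟩
    change G.succ.WalkLE (Quot.mk _ (j, s, u)) (Quot.mk _ (k, t, v))
      (2 * volume.real ((X j ⁻¹' halfEvent s (F u)) ∆ (X k ⁻¹' halfEvent t (F v))))
    by_cases hjk : j = k
    · subst hjk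
      rw [hsymm]
      have h₀ : ∀ y, 0 ≤ volume.real (F y) := fun y => measureReal_nonneg
      have h₁ : ∀ y, volume.real (F y) ≤ 1 := fun y => measureReal_le_one
      -- The factor 2 is inherited within one half; across the midpoint the walk bound holds without
      -- it.
      rcases s with _ | _ <;> rcases t with _ | _
      · refine ((hF.walk u v).succ_half j false).mono ?_
        rw [real_halfEvent_symmDiff]
        linarith
      · refine ((wcross j v u).reverse hG.succ).mono ?_
        rw [symmDiff_comm,
          real_halfEvent_symmDiff_true_false (hF.measurable v) (hF.measurable u)]
        linarith [h₀ v, h₁ u]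
      · refine (wcross j u v).mono ?_
        rw [real_halfEvent_symmDiff_true_false (hF.measurable u) (hF.measurable v)]
        linarith [h₀ u, h₁ v]
      · refine ((hF.walk u v).succ_half j true).mono ?_
        rw [real_halfEvent_symmDiff]
        linarith
    · rw [measureReal_symmDiff_of_indepFun (hX j).measurable (hX k).measurable (hind hjk)
        (hmeas s u) (hmeas t v)]
      exact walkLE_through_pole hG.succ measureReal_nonneg measureReal_le_one
        measureReal_nonneg measureReal_le_one (wtop j s u) (wbot j s u) (wtop k t v) (wbot k t v)

/-! ### From representations to the path metric and L₁ -/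

theorem EventRep.symmDiff_le_walk {G : PoledGraph} {F : G.V → Set I} (h : G.EventRep F)
    {x y : G.V} {L : ℝ≥0} (hL : G.Walk x y L) : volume.real (F x ∆ F y) ≤ L := by
  induction hL with
  | nil => simp
  | cons hw _ ih =>
    push_cast
    exact (measureReal_symmDiff_le _).trans (add_le_add (h.edge_le hw) ih)

theorem EventRep.symmDiff_le_pathDist {G : PoledGraph} (hG : G.Connected) {F : G.V → Set I}
    (h : G.EventRep F) (x y : G.V) : volume.real (F x ∆ F y) ≤ G.pathDist x y := by
  rw [← Real.toNNReal_le_iff_le_coe]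
  -- Connectedness is needed here: in `ℝ≥0` the infimum of the empty set is `0`.
  exact le_csInf (hG x y) fun L hL => Real.toNNReal_le_iff_le_coe.2 (h.symmDiff_le_walk hL)

theorem WalkLE.pathDist_le {G : PoledGraph} {x y : G.V} {r : ℝ} (h : G.WalkLE x y r) :
    (G.pathDist x y : ℝ) ≤ r :=
  let ⟨_, hL, hr⟩ := h
  (NNReal.coe_le_coe.2 (csInf_le (OrderBot.bddBelow _) hL)).trans hr

end PoledGraph

theorem diamond_undirected (e : LimitSequences) (α : Ordinal.{0}) :
    (diamond e α).Undirected := by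
  induction α using Ordinal.limitRecOn with
  | zero => rw [diamond_zero]; exact PoledGraph.single_undirected
  | add_one α ih => rw [diamond_add_one]; exact ih.succ
  | limit α hα ih =>
    rw [diamond_limit e α hα]
    exact PoledGraph.Undirected.union fun n => ih _ (e α hα n).2

theorem exists_eventRep_diamond (e : LimitSequences) (α : Ordinal.{0}) :
    ∃ F, (diamond e α).EventRep F := by
  induction α using Ordinal.limitRecOn with
  | zero => rw [diamond_zero]; exact ⟨_, PoledGraph.EventRep.single⟩
  | add_one α ih =>
    rw [diamond_add_one]
    exact PoledGraph.exists_eventRep_succ (diamond_undirected e α) ih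
  | limit α hα ih =>
    rw [diamond_limit e α hα]
    exact PoledGraph.exists_eventRep_union (fun n => diamond_undirected e _)
      fun n => ih _ (e α hα n).2

theorem mainTheorem8 (e : LimitSequences) (he : e.Enumerates)
    (α : Ordinal.{0}) (hα₀ : 0 < α) (hα : α < Ordinal.omega 1) :
    ∃ Ψ : (diamond e α).V →
        MeasureTheory.Lp ℝ 1 (MeasureTheory.volume.restrict (Set.Icc (0 : ℝ) 1)),
      ∀ x y : (diamond e α).V,
        (1 / 2 : ℝ) * ((diamond e α).pathDist x y : ℝ) ≤ ‖Ψ x - Ψ y‖ ∧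
          ‖Ψ x - Ψ y‖ ≤ ((diamond e α).pathDist x y : ℝ) := by
  obtain ⟨F, hF⟩ := exists_eventRep_diamond e α
  have hmeas : ∀ x, MeasurableSet (((↑) : I → ℝ) '' F x) := fun x =>
    (MeasurableEmbedding.subtype_coe measurableSet_Icc).measurableSet_image.2 (hF.measurable x)
  refine ⟨fun x => indicatorConstLp 1 (hmeas x) (measure_ne_top _ _) (1 : ℝ), fun x y => ?_⟩
  have hnorm : ‖indicatorConstLp (μ := volume.restrict (Icc (0 : ℝ) 1)) 1 (hmeas x)
      (measure_ne_top _ _) (1 : ℝ) - indicatorConstLp 1 (hmeas y) (measure_ne_top _ _) 1‖ =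
      volume.real (F x ∆ F y) := by
    -- The events were moved from `I` to `ℝ` as images; pulling back along the injective coercion
    -- recovers them.
    rw [← dist_eq_norm, dist_indicatorConstLp_eq_norm,
      norm_indicatorConstLp one_ne_zero ENNReal.one_ne_top,
      ← unitInterval.measurePreserving_coe.real_symmDiff_preimage (hmeas x) (hmeas y),
      preimage_image_eq _ Subtype.val_injective, preimage_image_eq _ Subtype.val_injective]
    simp
  rw [hnorm]
  exact ⟨by linarith [(hF.walk x y).pathDist_le],
    hF.symmDiff_le_pathDist (diamond_connected e α) x y⟩
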